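/- **Setting.** Three transmitters with $M\ge1$ antennas each and three receivers with $N\ge1$ antennas each share a library of $L\ge3$ independent files $W_1,\dots,W_L$, each uniform on $[2^F]$ ($F$ bits). Let $0\le\mu_T,\mu_R\le1$ with $\mu_R+3\mu_T\ge1$. Transmitter $i$ stores $U_i=\phi_i(W_1,\dots,W_L)\in[2^{\lfloor F\mu_TL\rfloor}]$ and receiver $j$ stores $V_j=\psi_j(W_1,\dots,W_L)\in[2^{\lfloor F\mu_RL\rfloor}]$. Arbitrary intra-file coding but no inter-file coding is allowed: each cache content is (up to an injective labelling) the collection of separate encodings of the individual files. For a demand $\mathbf d\in[L]^3$ (receiver $j$ wants $W_{d_j}$) and channel state $\mathbf H=(\mathbf H_{ij})$, with $\mathbf H_{ij}\in\mathbb C^{N\times M}$ having entries drawn i.i.d. from a continuous distribution, known at all nodes and constant during the transmission, transmitter $i$ maps $(U_i,\mathbf d,\mathbf H)$ to signals $\mathbf x_i(1),\dots,\mathbf x_i(T)\in\mathbb C^M$ with $\|\mathbf x_i(t)\|^2\le P$, where the block length $T$ may depend on $\mathbf d$ and $\mathbf H$. Receiver $j$ observes $\mathbf y_j(t)=\sum_{i=1}^3\mathbf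 H_{ij}\mathbf x_i(t)+\mathbf n_j(t)$, where the noise entries are i.i.d. $\mathcal{CN}(0,1)$, and computes an estimate $\hat W_j$ of $W_{d_j}$ from $V_j$, $(\mathbf y_j(t))_{t\le T}$, $\mathbf H$ and $\mathbf d$. A scheme is a family of such caching, encoding and decoding functions, one for each power $P$ and each file length $F$. It is feasible if for every $P>0$ and almost every $\mathbf H$, $\max_{\mathbf d}\max_j\mathbb P(\hat W_j\ne W_{d_j})\to0$ as $F\to\infty$. Its normalized delivery time (NDT) in the channel $\mathbf H$ is $$\lim_{P\to\infty}\limsup_{F\to\infty}\frac{\max_{\mathbf d}T}{F/\log_2P}$$ (when the limit exists, possibly infinite). A value $\tau$ is achievable if some feasible scheme has, for almost every $\mathbf H$, an NDT that is at most $\tau$, and the minimum NDT $\tau^*(\mu_R,\mu_T)$ is the infimum of the achievable values. **Theorem (Lower Bound).** The minimum NDT of the $3\times3$ cache-aided MIMO interference network satisfies $$\tau^*(\mu_R,\mu_T)\ \ge\ \max\left\{\frac{1-\mu_R}{N},\ \max_{s\in\{1,2,3\}}\frac{s(1-s\mu_R)}{3M}\right\}.$$ -/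

import Mathlib

open MeasureTheory ProbabilityTheory Filter Topology

noncomputable section

namespace CacheMIMO

/-- A library of `L` files of `F` bits each, i.e. an element of `[2^F]^L`. -/
abbrev Library (L F : ℕ) : Type := Fin L → Fin (2 ^ F)

/-- The demand vector of the three receivers: receiver `j` requests file `d j`. -/
abbrev Demand (L : ℕ) : Type := Fin 3 → Fin L

/-- Channel state: `H i j` is the `N × M` matrix from transmitter `i` to receiver `j`. -/
abbrev CSI (M N : ℕ) : Type := Fin 3 → Fin 3 → Fin N → Fin M → ℂ

/-- The contents of a cache of `⌊F Q⌋` bits, where `Q = μ L` and `μ` is the normalized size. -/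
abbrev CacheContent (L F : ℕ) (μ : ℝ) : Type := Fin (2 ^ ⌊(F : ℝ) * (μ * L)⌋₊)

/-- Intra-file but no inter-file coding: every file is encoded separately (by an arbitrary
function `g l` of that file alone), and the cache stores precisely the collection of these
encodings, through an injective labelling of the possible collections. -/
def NoInterFileCoding {L F K : ℕ} (φ : Library L F → Fin K) : Prop :=
  ∃ (c : Fin L → ℕ) (g : (l : Fin L) → Fin (2 ^ F) → Fin (c l))
    (e : ((l : Fin L) → Fin (c l)) ↪ Fin K),
    ∀ w : Library L F, φ w = e (fun l => g l (w l))

/-- A caching and coding scheme for file length `F` and transmit power `P`. -/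
structure Code (L M N : ℕ) (μT μR : ℝ) (F : ℕ) (P : ℝ) where
  /-- caching functions of the transmitters -/
  txCache : Fin 3 → Library L F → CacheContent L F μT
  /-- caching functions of the receivers -/
  rxCache : Fin 3 → Library L F → CacheContent L F μR
  txCache_noInterFile : ∀ i, NoInterFileCoding (txCache i)
  rxCache_noInterFile : ∀ j, NoInterFileCoding (rxCache j)
  /-- the block length, which may depend on the demand and on the channel state -/
  blockLength : Demand L → CSI M N → ℕ
  /-- encoding functions: cache content to the signal vectors of all time slots -/
  encode : (i : Fin 3) → (d : Demand L) → (H : CSI M N) →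
    CacheContent L F μT → Fin (blockLength d H) → Fin M → ℂ
  power_le : ∀ i d H u t, ∑ m, ‖encode i d H u t m‖ ^ 2 ≤ P
  /-- decoding functions: cache content and received signals to the estimated file -/
  decode : (j : Fin 3) → (d : Demand L) → (H : CSI M N) →
    CacheContent L F μR → (Fin (blockLength d H) → Fin N → ℂ) → Fin (2 ^ F)
  measurable_decode : ∀ j d H v, Measurable (decode j d H v)

/-- The circularly symmetric complex Gaussian law with mean zero and unit variance. -/
def complexGaussian : Measure ℂ :=
  ((gaussianReal 0 (1 / 2)).prod (gaussianReal 0 (1 / 2))).map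
    Complex.measurableEquivRealProd.symm

/-- The noise at all receivers, in all `T` time slots and at all `N` antennas: i.i.d. entries. -/
def noiseLaw (T N : ℕ) : Measure (Fin 3 → Fin T → Fin N → ℂ) :=
  Measure.pi fun _ => Measure.pi fun _ => Measure.pi fun _ => complexGaussian

/-- The files are independent and uniformly distributed. -/
def libraryLaw (L F : ℕ) : Measure (Library L F) :=
  Measure.pi fun _ => uniformOn Set.univ

/-- The channel coefficients are i.i.d. with law `ν`. -/
def channelLaw (M N : ℕ) (ν : Measure ℂ) : Measure (CSI M N) :=
  Measure.pi fun _ => Measure.pi fun _ => Measure.pi fun _ => Measure.pi fun _ => ν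

namespace Code

variable {L M N F : ℕ} {μT μR P : ℝ}

/-- The received signal `y_j(t) = ∑ i, H_ij x_i(t) + n_j(t)` when the library is `w` and the
noise is `n`. -/
def received (C : Code L M N μT μR F P) (d : Demand L) (H : CSI M N) (w : Library L F)
    (n : Fin 3 → Fin (C.blockLength d H) → Fin N → ℂ) (j : Fin 3) :
    Fin (C.blockLength d H) → Fin N → ℂ :=
  fun t a => (∑ i, ∑ m, H i j a m * C.encode i d H (C.txCache i w) t m) + n j t a

/-- The estimate of the requested file at receiver `j`. -/
def estimate (C : Code L M N μT μR F P) (d : Demand L) (H : CSI M N) (w : Library L F)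
    (n : Fin 3 → Fin (C.blockLength d H) → Fin N → ℂ) (j : Fin 3) : Fin (2 ^ F) :=
  C.decode j d H (C.rxCache j w) (C.received d H w n j)

/-- The error probability of receiver `j` for demand `d` in the channel `H`. -/
def errorProb (C : Code L M N μT μR F P) (d : Demand L) (H : CSI M N) (j : Fin 3) : ENNReal :=
  ((libraryLaw L F).prod (noiseLaw (C.blockLength d H) N))
    {p | C.estimate d H p.1 p.2 j ≠ p.1 (d j)}

/-- The worst-case error probability in the channel `H`. -/
def worstErrorProb (C : Code L M N μT μR F P) (H : CSI M N) : ENNReal :=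
  ⨆ d : Demand L, ⨆ j : Fin 3, C.errorProb d H j

/-- The worst-case block length `max_d T` in the channel `H`. -/
def maxBlockLength (C : Code L M N μT μR F P) (H : CSI M N) : ℕ :=
  Finset.univ.sup fun d : Demand L => C.blockLength d H

end Code

/-- A family of caching and coding schemes, one for each power and each file length. -/
abbrev Scheme (L M N : ℕ) (μT μR : ℝ) : Type :=
  (P : ℝ) → (F : ℕ) → Code L M N μT μR F P

namespace Scheme

variable {L M N : ℕ} {μT μR : ℝ}

/-- For almost all channel realizations the worst-case error probability vanishes as the file
length tends to infinity, at every power. -/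
def Feasible (ν : Measure ℂ) (S : Scheme L M N μT μR) : Prop :=
  ∀ P : ℝ, 0 < P → ∀ᵐ H ∂(channelLaw M N ν),
    Tendsto (fun F => (S P F).worstErrorProb H) atTop (𝓝 0)

/-- `limsup_{F → ∞} (max_d T) / (F / log P)`; the logarithm is to base 2 because files are
measured in bits. -/
def deliveryTime (S : Scheme L M N μT μR) (H : CSI M N) (P : ℝ) : EReal :=
  limsup (fun F : ℕ =>
    ((((S P F).maxBlockLength H : ℝ) / ((F : ℝ) / Real.logb 2 P) : ℝ) : EReal)) atTop

/-- In the channel `H` the scheme has normalized delivery time `τ`: the limit over `P → ∞`. -/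
def HasNDT (S : Scheme L M N μT μR) (H : CSI M N) (τ : EReal) : Prop :=
  Tendsto (fun P : ℝ => S.deliveryTime H P) atTop (𝓝 τ)

end Scheme

/-- `τ` is achievable: for some feasible scheme, the NDT exists and is at most `τ` for almost
all channel realizations. -/
def AchievableNDT (L M N : ℕ) (μT μR : ℝ) (ν : Measure ℂ) (τ : EReal) : Prop :=
  ∃ S : Scheme L M N μT μR, S.Feasible ν ∧
    ∀ᵐ H ∂(channelLaw M N ν), ∃ τ' : EReal, S.HasNDT H τ' ∧ τ' ≤ τ

/-- The minimum NDT (`⊤` if nothing is achievable). -/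
def minNDT (L M N : ℕ) (μT μR : ℝ) (ν : Measure ℂ) : EReal :=
  sInf {τ : EReal | AchievableNDT L M N μT μR ν τ}

end CacheMIMO

end

/-! The theorem is a cut-set bound, proved by counting messages rather than by entropy inequalities.
Fix a set `J` of `s` receivers with distinct demands and reveal every file that `J` does not
request. What the caches of `J` hold about the requested files, together with the noisy signals at
`J`, must then determine those `s` files with probability at least 1/2. So `2 ^ (F * s)` is at most
a constant times the number of such cache contents times the number of distinguishable signals
(`Code.two_pow_le`).

Distinguishable signals are counted by quantization. If the noiseless signals in a slot are linear
images of `m` scalars of size `O(√P)`, they lie within distance 1 of `O(P ^ m)` points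
(`exists_finset_cover_linear_image`). The law of the noisy signal is dominated by a finite measure
that depends only on the quantized point, at the cost of a constant factor per slot
(`map_add_noiseLaw_le`). Since caches do not mix files, averaging over cyclically shifted demands
bounds the cache term by `F * s² * μR` bits (`Code.exists_demand`).

Taking logarithms, `F * s ≤ 1 + F * s² * μR + T * (m * log P + O(1))`. Letting `F → ∞` and then `P →
∞` gives `s * (1 - s * μR) / m` (`Scheme.HasNDT.le`). One receiver has `m = N`, from its own
antennas; any `s` receivers have `m = 3 * M`, from all transmit antennas. -/

namespace MeasureTheory.Measure

/-- Finite products of measures are monotone in every factor. -/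
theorem pi_le_pi {ι : Type*} [Fintype ι] {α : ι → Type*} [∀ i, MeasurableSpace (α i)]
    {μ ν : ∀ i, Measure (α i)} [∀ i, SigmaFinite (μ i)] (h : ∀ i, μ i ≤ ν i) :
    Measure.pi μ ≤ Measure.pi ν := by
  rw [Measure.le_iff]
  intro s hs
  rw [Measure.pi_def ν, toMeasure_apply _ _ hs]
  -- The product outer measure is the largest one bounded on boxes by the product of the factors, so
  -- a comparison on boxes is enough.
  suffices H : (Measure.pi μ).toOuterMeasure ≤
      OuterMeasure.pi fun i => (ν i).toOuterMeasure from H s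
  rw [OuterMeasure.le_pi]
  intro t _
  change Measure.pi μ (Set.pi Set.univ t) ≤ _
  rw [Measure.pi_pi]
  exact Finset.prod_le_prod' fun i _ => h i (t i)

end MeasureTheory.Measure

/-! ### Domination of shifted Gaussian noise -/

namespace CacheMIMO

/-- A Gaussian law of variance `1 / 2` is dominated by a multiple of a Gaussian law of variance
`1` whose mean is at distance at most `1`. -/
theorem gaussianReal_le_smul_gaussianReal {x q : ℝ} (h : |x - q| ≤ 1) :
    gaussianReal x (1 / 2) ≤
      ENNReal.ofReal (√2 * Real.exp 1) • gaussianReal q 1 := by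
  rw [gaussianReal_of_var_ne_zero _ (by norm_num), gaussianReal_of_var_ne_zero _ one_ne_zero,
    ← withDensity_smul _ (measurable_gaussianPDF q 1)]
  refine withDensity_mono (Eventually.of_forall fun y => ?_)
  simp only [gaussianPDF, Pi.smul_apply, smul_eq_mul]
  rw [← ENNReal.ofReal_mul (by positivity)]
  refine ENNReal.ofReal_le_ofReal ?_
  simp only [gaussianPDFReal]
  have h1 : (√(2 * Real.pi * ((1 / 2 : NNReal) : ℝ)))⁻¹ = √2 * (√(2 * Real.pi * ((1 : NNReal) : ℝ)))⁻¹ := by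
    have h2 : (√2 : ℝ) ≠ 0 := by positivity
    have h3 : √Real.pi ≠ 0 := by positivity
    push_cast
    rw [show 2 * Real.pi * (1 / 2) = Real.pi by ring, mul_one,
      Real.sqrt_mul (by norm_num)]
    field_simp
  rw [h1, mul_assoc, mul_assoc √2 (Real.exp 1), mul_left_comm (Real.exp 1)]
  gcongr
  rw [← Real.exp_add]
  refine Real.exp_le_exp.2 ?_
  push_cast
  have := abs_le.1 h
  -- The exponents compare through `(y - q)² ≤ 2 (y - x)² + 2 (x - q)²`. The larger variance absorbs
  -- the shift, leaving only the factor `exp 1`.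
  have h5 : (x - q) ^ 2 ≤ 1 := by nlinarith
  nlinarith [sq_nonneg (y - x - (x - q))]

instance : IsProbabilityMeasure complexGaussian := by
  unfold complexGaussian
  exact Measure.isProbabilityMeasure_map (by fun_prop)

theorem map_add_complexGaussian (x : ℂ) :
    complexGaussian.map (fun n => x + n) =
      ((gaussianReal x.re (1 / 2)).prod (gaussianReal x.im (1 / 2))).map
        Complex.measurableEquivRealProd.symm := by
  unfold complexGaussian
  have h1 : ∀ u : ℝ, gaussianReal u (1 / 2) = (gaussianReal 0 (1 / 2)).map (fun n => u + n) := by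
    intro u
    rw [gaussianReal_map_const_add, zero_add]
  rw [h1 x.re, h1 x.im, Measure.map_prod_map _ _ (by fun_prop) (by fun_prop),
    Measure.map_map (by fun_prop) (by fun_prop), Measure.map_map (by fun_prop) (by fun_prop)]
  congr 1

/-- A multiple of the circularly symmetric complex Gaussian law with mean `q` and variance `2`. It
dominates the laws of all noisy observations of points at distance at most `1` from `q`. -/
noncomputable def dominatingGaussian (q : ℂ) : Measure ℂ :=
  ((ENNReal.ofReal (√2 * Real.exp 1) • gaussianReal q.re 1).prod
    (ENNReal.ofReal (√2 * Real.exp 1) • gaussianReal q.im 1)).map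
      Complex.measurableEquivRealProd.symm

theorem dominatingGaussian_univ (q : ℂ) :
    dominatingGaussian q Set.univ = ENNReal.ofReal (2 * Real.exp 2) := by
  unfold dominatingGaussian
  rw [Measure.map_apply (by fun_prop) MeasurableSet.univ, Set.preimage_univ,
    ← Set.univ_prod_univ, Measure.prod_prod]
  simp only [Measure.smul_apply, measure_univ, smul_eq_mul, mul_one]
  rw [← ENNReal.ofReal_mul (by positivity)]
  congr 1
  rw [mul_mul_mul_comm, ← Real.exp_add, Real.mul_self_sqrt (by norm_num)]
  norm_num

instance (q : ℂ) : IsFiniteMeasure (dominatingGaussian q) :=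
  ⟨by rw [dominatingGaussian_univ]; exact ENNReal.ofReal_lt_top⟩

theorem map_add_complexGaussian_le {x q : ℂ} (h : ‖x - q‖ ≤ 1) :
    complexGaussian.map (fun n => x + n) ≤ dominatingGaussian q := by
  rw [map_add_complexGaussian, dominatingGaussian]
  refine Measure.map_mono (Measure.prod_mono ?_ ?_) (by fun_prop)
  · exact gaussianReal_le_smul_gaussianReal ((Complex.abs_re_le_norm (x - q)).trans h)
  · exact gaussianReal_le_smul_gaussianReal ((Complex.abs_im_le_norm (x - q)).trans h)

/-- The law of the noise shifted by a signal is dominated by a finite measure which depends only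
on a rounded version `q` of the signal. -/
theorem map_add_noiseLaw_le {T N : ℕ} {x q : Fin 3 → Fin T → Fin N → ℂ}
    (h : ∀ j t a, ‖x j t a - q j t a‖ ≤ 1) :
    (noiseLaw T N).map (fun n j t a => x j t a + n j t a) ≤
      Measure.pi fun j => Measure.pi fun t => Measure.pi fun a => dominatingGaussian (q j t a) := by
  unfold noiseLaw
  have hp : ∀ z : ℂ, IsProbabilityMeasure (complexGaussian.map (fun n => z + n)) := fun z =>
    Measure.isProbabilityMeasure_map (by fun_prop)
  have e1 : ∀ y : Fin N → ℂ, (Measure.pi fun _ : Fin N => complexGaussian).map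
      (fun n a => y a + n a) = Measure.pi fun a => complexGaussian.map (fun n => y a + n) :=
    fun y => Measure.pi_map_pi (f := fun a n => y a + n) fun a => by fun_prop
  have e2 : ∀ y : Fin T → Fin N → ℂ,
      (Measure.pi fun _ : Fin T => Measure.pi fun _ : Fin N => complexGaussian).map
      (fun n t a => y t a + n t a) =
        Measure.pi fun t => Measure.pi fun a => complexGaussian.map (fun n => y t a + n) := by
    intro y
    have hs : ∀ t, SigmaFinite ((Measure.pi fun _ : Fin N => complexGaussian).map
      (fun n a => y t a + n a)) := fun t => by rw [e1]; infer_instance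
    rw [Measure.pi_map_pi (f := fun t (n : Fin N → ℂ) a => y t a + n a) fun a => Measurable.aemeasurable (by fun_prop)]
    simp only [e1]
  have hs : ∀ j, SigmaFinite ((Measure.pi fun _ : Fin T => Measure.pi fun _ : Fin N =>
      complexGaussian).map (fun n t a => x j t a + n t a)) := fun t => by
    rw [e2]; infer_instance
  rw [Measure.pi_map_pi (f := fun j (n : Fin T → Fin N → ℂ) t a => x j t a + n t a) fun a => Measurable.aemeasurable (by fun_prop)]
  simp only [e2]
  exact Measure.pi_le_pi fun j => Measure.pi_le_pi fun t => Measure.pi_le_pi fun a =>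
    map_add_complexGaussian_le (h j t a)

/-- The mass does not depend on `q`, and per slot it is a constant free of `P`. Domination thus
costs `O(1)` bits per slot, negligible against `log P`. -/
theorem pi_dominatingGaussian_univ {T N : ℕ} (q : Fin 3 → Fin T → Fin N → ℂ) :
    (Measure.pi fun j => Measure.pi fun t => Measure.pi fun a => dominatingGaussian (q j t a))
      Set.univ = ENNReal.ofReal ((2 * Real.exp 2) ^ (3 * N)) ^ T := by
  simp only [Measure.pi_univ, dominatingGaussian_univ, Finset.prod_const, Finset.card_univ,
    Fintype.card_fin]
  rw [ENNReal.ofReal_pow (by positivity), ← pow_mul, ← pow_mul, ← pow_mul]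
  congr 1
  ring

end CacheMIMO

/-! ### Counting, covering and averaging -/

namespace CacheMIMO

/-- A list-decoding count: if messages with the same label have disjoint decision regions, then the
measures of all the decision regions add up to at most the number of labels times the total mass. -/
theorem sum_measure_le_card_mul {W Λ Y : Type*} [Fintype W] [Fintype Λ] [MeasurableSpace Y]
    (μ : Measure Y) (A : W → Set Y) (hA : ∀ w, MeasurableSet (A w)) (label : W → Λ)
    (hdisj : ∀ w w', label w = label w' → w ≠ w' → Disjoint (A w) (A w')) :
    ∑ w, μ (A w) ≤ Fintype.card Λ * μ Set.univ := by
  classical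
  rw [← Finset.sum_fiberwise Finset.univ label (fun w => μ (A w))]
  calc ∑ b, ∑ w with label w = b, μ (A w) ≤ ∑ _b : Λ, μ Set.univ := by
        refine Finset.sum_le_sum fun b _ => ?_
        rw [← measure_biUnion_finset _ fun w _ => hA w]
        · exact measure_mono (Set.subset_univ _)
        · intro w hw w' hw' hne
          simp only [Finset.coe_filter, Finset.mem_univ, true_and, Set.mem_ofPred_eq] at hw hw'
          exact hdisj w w' (hw.trans hw'.symm) hne
    _ = Fintype.card Λ * μ Set.univ := by simp

/-- The same count when the law of the observation depends on the message, but is dominated by one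
of `K.card` measures of mass at most `m`. -/
theorem sum_measure_le_card_mul_card_mul {W Λ Y κ : Type*} [Fintype W] [Fintype Λ]
    [MeasurableSpace Y] (ρ : W → Measure Y) (K : Finset κ) (μ : κ → Measure Y)
    (k : W → κ) (hk : ∀ w, k w ∈ K) (hρ : ∀ w, ρ w ≤ μ (k w)) (m : ENNReal)
    (hm : ∀ i, μ i Set.univ ≤ m) (A : W → Set Y) (hA : ∀ w, MeasurableSet (A w)) (label : W → Λ)
    (hdisj : ∀ w w', label w = label w' → w ≠ w' → Disjoint (A w) (A w')) :
    ∑ w, ρ w (A w) ≤ K.card * (Fintype.card Λ * m) :=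
  calc ∑ w, ρ w (A w) ≤ ∑ w, ∑ i ∈ K, μ i (A w) := Finset.sum_le_sum fun w _ =>
        (hρ w (A w)).trans
          (Finset.single_le_sum (f := fun i => μ i (A w)) (fun _ _ => zero_le) (hk w))
    _ = ∑ i ∈ K, ∑ w, μ i (A w) := Finset.sum_comm
    _ ≤ ∑ _i ∈ K, Fintype.card Λ * m := Finset.sum_le_sum fun i _ =>
        (sum_measure_le_card_mul (μ i) A hA label hdisj).trans (by gcongr; exact hm i)
    _ = K.card * (Fintype.card Λ * m) := by simp

/-- The linear image of a polydisc of radius `r` in `ℂ^κ` is covered by a number of unit polydiscs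
which grows at most like `r ^ (2 * card κ)`, regardless of the dimension of the ambient space. -/
theorem exists_finset_cover_linear_image {κ o : Type*} [Fintype κ] [Fintype o]
    (G : o → κ → ℂ) :
    ∃ b : ℝ, 1 ≤ b ∧ ∀ r : ℝ, 0 ≤ r → ∃ Q : Finset (o → ℂ),
      (Q.card : ℝ) ≤ (b * r + b) ^ (2 * Fintype.card κ) ∧
      ∀ z : κ → ℂ, (∀ k, ‖z k‖ ≤ r) → ∃ q ∈ Q, ∀ i, ‖∑ k, G i k * z k - q i‖ ≤ 1 := by
  classical
  set g : ℝ := ∑ i, ∑ k, ‖G i k‖ with hg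
  have hg0 : 0 ≤ g := by positivity
  -- The grid lives in the source `ℂ^κ`, with mesh `1 / D`. Rounding moves each coordinate by at
  -- most `2 / D`, hence the image by at most `2 * g / D < 1`.
  set D : ℝ := 2 * g + 1 with hD
  have hD0 : 0 < D := by positivity
  refine ⟨2 * D + 5, by linarith, fun r hr => ?_⟩
  set n : ℕ := ⌈D * r⌉₊ + 1 with hn
  let box : Finset (ℤ × ℤ) := Finset.Icc (-(n : ℤ)) n ×ˢ Finset.Icc (-(n : ℤ)) n
  let pt : ℤ × ℤ → ℂ := fun p => ⟨p.1 / D, p.2 / D⟩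
  refine ⟨(Fintype.piFinset fun _ : κ => box).image fun p i => ∑ k, G i k * pt (p k), ?_, ?_⟩
  · have hbox : (box.card : ℝ) = (2 * n + 1) ^ 2 := by
      have : (Finset.Icc (-(n : ℤ)) n).card = 2 * n + 1 := by
        rw [Int.card_Icc]; omega
      simp only [box, Finset.card_product, this]
      push_cast; ring
    calc _ ≤ (((Fintype.piFinset fun _ : κ => box).card : ℕ) : ℝ) := by
          exact_mod_cast Finset.card_image_le
      _ = ((2 * n + 1 : ℝ) ^ 2) ^ Fintype.card κ := by
          rw [Fintype.card_piFinset]; push_cast; simp [hbox]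
      _ = (2 * n + 1 : ℝ) ^ (2 * Fintype.card κ) := by rw [← pow_mul]
      _ ≤ _ := by
          have h1 := Nat.ceil_lt_add_one (show 0 ≤ D * r by positivity)
          have h2 : (n : ℝ) = (⌈D * r⌉₊ : ℝ) + 1 := by rw [hn]; push_cast; ring
          refine pow_le_pow_left₀ (by positivity) ?_ _
          nlinarith
  · intro z hz
    have key : ∀ u : ℝ, |u| ≤ r → ⌊D * u⌋ ∈ Finset.Icc (-(n : ℤ)) n ∧
        |u - (⌊D * u⌋ : ℝ) / D| ≤ 1 / D := by
      intro u hu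
      have h1 := Nat.le_ceil (D * r)
      have h2 := abs_le.1 hu
      have h3 : D * u ≤ D * r := by gcongr; exact h2.2
      have h4 : -(D * r) ≤ D * u := by nlinarith
      have h5 := Int.floor_le (D * u)
      have h6 := Int.lt_floor_add_one (D * u)
      refine ⟨?_, ?_⟩
      · rw [Finset.mem_Icc]
        have hnr : (n : ℝ) = (⌈D * r⌉₊ : ℝ) + 1 := by rw [hn]; push_cast; ring
        constructor
        · have : (-(n : ℤ) : ℝ) ≤ (⌊D * u⌋ : ℝ) := by push_cast; linarith
          exact_mod_cast this
        · have : (⌊D * u⌋ : ℝ) ≤ ((n : ℤ) : ℝ) := by push_cast; linarith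
          exact_mod_cast this
      · have e : u - (⌊D * u⌋ : ℝ) / D = (D * u - ⌊D * u⌋) / D := by field_simp
        rw [e, abs_div, abs_of_pos hD0]
        gcongr
        rw [abs_le]; constructor <;> linarith
    let p : κ → ℤ × ℤ := fun k => (⌊D * (z k).re⌋, ⌊D * (z k).im⌋)
    refine ⟨_, Finset.mem_image_of_mem _ (a := p) ?_, ?_⟩
    · rw [Fintype.mem_piFinset]
      intro k
      exact Finset.mem_product.2
        ⟨(key _ ((Complex.abs_re_le_norm _).trans (hz k))).1,
          (key _ ((Complex.abs_im_le_norm _).trans (hz k))).1⟩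
    · intro i
      have hk : ∀ k, ‖z k - pt (p k)‖ ≤ 2 / D := by
        intro k
        refine (Complex.norm_le_abs_re_add_abs_im _).trans ?_
        have a1 := (key _ ((Complex.abs_re_le_norm _).trans (hz k))).2
        have a2 := (key _ ((Complex.abs_im_le_norm _).trans (hz k))).2
        have : 2 / D = 1 / D + 1 / D := by ring
        rw [this]
        exact add_le_add a1 a2
      rw [← Finset.sum_sub_distrib]
      calc ‖∑ k, (G i k * z k - G i k * pt (p k))‖
          ≤ ∑ k, ‖G i k‖ * (2 / D) := by
            refine (norm_sum_le _ _).trans (Finset.sum_le_sum fun k _ => ?_)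
            rw [← mul_sub, norm_mul]
            gcongr
            exact hk k
        _ = (∑ k, ‖G i k‖) * (2 / D) := by rw [Finset.sum_mul]
        _ ≤ g * (2 / D) := by
            gcongr
            exact Finset.single_le_sum (f := fun i => ∑ k, ‖G i k‖)
              (fun _ _ => by positivity) (Finset.mem_univ i)
        _ ≤ 1 := by
            rw [← mul_div_assoc, div_le_one hD0]; linarith

/-- A function on a cyclic group takes, on some translate of a set, a sum which is at most average. -/
theorem exists_sum_translate_le {A : Type*} [AddCommGroup A] [Fintype A] [Nonempty A]
    (f : A → ℝ) (S : Finset A) (B : ℝ) (hf : ∑ a, f a ≤ B * Fintype.card A) :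
    ∃ a, ∑ x ∈ S, f (a + x) ≤ S.card * B := by
  by_contra! h
  have h1 : ∑ _a : A, S.card * B < ∑ a, ∑ x ∈ S, f (a + x) :=
    Finset.sum_lt_sum_of_nonempty Finset.univ_nonempty fun a _ => h a
  rw [Finset.sum_comm] at h1
  have h2 : ∀ x, ∑ a, f (a + x) = ∑ a, f a := fun x =>
    Equiv.sum_comp (Equiv.addRight x) f
  simp only [h2, Finset.sum_const, nsmul_eq_mul, Finset.card_univ] at h1
  nlinarith [mul_le_mul_of_nonneg_left hf (Nat.cast_nonneg (α := ℝ) S.card)]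

end CacheMIMO

/-! ### The counting converse for a single code -/

namespace CacheMIMO

theorem libraryLaw_singleton (L F : ℕ) (w : Library L F) :
    libraryLaw L F {w} = ((2 ^ F) ^ L)⁻¹ := by
  have h : ({w} : Set (Library L F)) = Set.pi Set.univ fun i => {w i} := by
    ext v; simp [funext_iff]
  rw [libraryLaw, h, Measure.pi_pi]
  simp [uniformOn_univ, ENNReal.inv_pow]

/-- Uniformity of the files turns a probability into a sum over libraries, the form that the
list-decoding count bounds. -/
theorem libraryLaw_prod_apply {L F : ℕ} {Y : Type*} [MeasurableSpace Y] (μ : Measure Y)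
    [SFinite μ] (S : Set (Library L F × Y)) (hS : MeasurableSet S) :
    (2 ^ F) ^ L * ((libraryLaw L F).prod μ) S = ∑ w, μ (Prod.mk w ⁻¹' S) := by
  rw [Measure.prod_apply hS, lintegral_fintype, Finset.mul_sum]
  refine Finset.sum_congr rfl fun w _ => ?_
  rw [libraryLaw_singleton, mul_left_comm, ENNReal.mul_inv_cancel (by positivity) (by finiteness),
    mul_one]

instance (L F : ℕ) : IsProbabilityMeasure (libraryLaw L F) := by
  unfold libraryLaw
  infer_instance

instance (T N : ℕ) : IsProbabilityMeasure (noiseLaw T N) := by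
  unfold noiseLaw
  infer_instance

namespace Code

variable {L M N F : ℕ} {μT μR P : ℝ}

theorem measurable_estimate (C : Code L M N μT μR F P) (d : Demand L) (H : CSI M N)
    (w : Library L F) (j : Fin 3) : Measurable fun n => C.estimate d H w n j := by
  unfold estimate
  refine (C.measurable_decode j d H _).comp ?_
  unfold received
  fun_prop

theorem measurableSet_estimate_eq (C : Code L M N μT μR F P) (d : Demand L) (H : CSI M N)
    (J : Finset (Fin 3)) : MeasurableSet
      {p : Library L F × (Fin 3 → Fin (C.blockLength d H) → Fin N → ℂ) |
        ∀ j ∈ J, C.estimate d H p.1 p.2 j = p.1 (d j)} := by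
  have h : {p : Library L F × (Fin 3 → Fin (C.blockLength d H) → Fin N → ℂ) |
        ∀ j ∈ J, C.estimate d H p.1 p.2 j = p.1 (d j)} =
      ⋃ w, {w} ×ˢ ⋂ j ∈ J, (fun n => C.estimate d H w n j) ⁻¹' {w (d j)} := by
    ext ⟨w, n⟩
    simp
  rw [h]
  exact MeasurableSet.iUnion fun w => (measurableSet_singleton w).prod <|
    Finset.measurableSet_biInter _ fun j _ =>
      C.measurable_estimate d H w j (measurableSet_singleton _)

/-- A union bound over three receivers: `3 * 6⁻¹ = 2⁻¹`. Any fixed success probability would do, as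
it costs only a constant number of bits in total. -/
theorem half_le_prod_estimate_eq (C : Code L M N μT μR F P) (d : Demand L) (H : CSI M N)
    (J : Finset (Fin 3)) (herr : ∀ j, C.errorProb d H j ≤ 6⁻¹) :
    2⁻¹ ≤ ((libraryLaw L F).prod (noiseLaw (C.blockLength d H) N))
      {p | ∀ j ∈ J, C.estimate d H p.1 p.2 j = p.1 (d j)} := by
  set S := {p : Library L F × (Fin 3 → Fin (C.blockLength d H) → Fin N → ℂ) |
    ∀ j ∈ J, C.estimate d H p.1 p.2 j = p.1 (d j)} with hS
  set μ := (libraryLaw L F).prod (noiseLaw (C.blockLength d H) N)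
  have h1 : μ Sᶜ ≤ 2⁻¹ := by
    calc μ Sᶜ ≤ μ (⋃ j : Fin 3, {p | C.estimate d H p.1 p.2 j ≠ p.1 (d j)}) := by
          refine measure_mono fun p hp => ?_
          simp only [hS, Set.mem_compl_iff, Set.mem_ofPred_eq, not_forall] at hp
          obtain ⟨j, _, hj⟩ := hp
          exact Set.mem_iUnion.2 ⟨j, hj⟩
      _ ≤ ∑ j : Fin 3, μ {p | C.estimate d H p.1 p.2 j ≠ p.1 (d j)} := measure_iUnion_fintype_le _ _
      _ ≤ ∑ _j : Fin 3, 6⁻¹ := Finset.sum_le_sum fun j _ => herr j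
      _ = 2⁻¹ := by
          rw [Finset.sum_const, Finset.card_univ, Fintype.card_fin, nsmul_eq_mul,
            ← ENNReal.toReal_eq_toReal_iff' (by finiteness) (by finiteness)]
          norm_num
  have h2 : (1 : ENNReal) = μ S + μ Sᶜ := by
    rw [measure_add_measure_compl (C.measurableSet_estimate_eq d H J), measure_univ]
  have h3 : (2⁻¹ : ENNReal) + 2⁻¹ ≤ μ S + 2⁻¹ := by
    rw [ENNReal.inv_two_add_inv_two, h2]
    gcongr
  exact (ENNReal.add_le_add_iff_right (by finiteness)).1 h3

/-- The noiseless signal at receiver `j`. -/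
def noiseless (C : Code L M N μT μR F P) (d : Demand L) (H : CSI M N) (w : Library L F)
    (j : Fin 3) (t : Fin (C.blockLength d H)) (a : Fin N) : ℂ :=
  ∑ i, ∑ m, H i j a m * C.encode i d H (C.txCache i w) t m

/-- The converse for a single code. If the receivers in `J` decode distinct files, and their
noiseless signals lie in each time slot within distance `1` of a finite set `Q`, then the files
requested by `J` are, up to a constant, not more numerous than the possible contents of the caches
of `J` regarding these files times the number of quantized signals. -/
theorem two_pow_le (C : Code L M N μT μR F P) (d : Demand L) (hd : Function.Injective d)
    (H : CSI M N) (J : Finset (Fin 3)) (herr : ∀ j, C.errorProb d H j ≤ 6⁻¹)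
    (Q : Finset (Fin 3 × Fin N → ℂ))
    (hQ : ∀ w t, ∃ q ∈ Q, ∀ j ∈ J, ∀ a, ‖C.noiseless d H w j t a - q (j, a)‖ ≤ 1)
    (c : Fin 3 → Fin L → ℕ) (g : (j : Fin 3) → (l : Fin L) → Fin (2 ^ F) → Fin (c j l))
    (hg : ∀ j w w', (∀ l, g j l (w l) = g j l (w' l)) → C.rxCache j w = C.rxCache j w') :
    (2 : ℝ) ^ (F * J.card) ≤ 2 * (∏ j ∈ J, ∏ i ∈ J, (c j (d i) : ℝ)) *
      (Q.card * (2 * Real.exp 2) ^ (3 * N)) ^ C.blockLength d H := by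
  classical
  set T := C.blockLength d H with hT
  choose k hkQ hk using hQ
  -- Signals outside `J` are replaced by zero: the decision regions ignore them, and `Q` need not
  -- cover them.
  let X : Library L F → Fin 3 → Fin T → Fin N → ℂ := fun w j t a =>
    if j ∈ J then C.noiseless d H w j t a else 0
  let A : Library L F → Set (Fin 3 → Fin T → Fin N → ℂ) := fun w =>
    {y | ∀ j ∈ J, C.decode j d H (C.rxCache j w) (y j) = w (d j)}
  have hA : ∀ w, MeasurableSet (A w) := by
    intro w
    have : A w = ⋂ j ∈ J, (fun y : Fin 3 → Fin T → Fin N → ℂ =>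
        C.decode j d H (C.rxCache j w) (y j)) ⁻¹' {w (d j)} := by
      ext y; simp [A]
    rw [this]
    exact Finset.measurableSet_biInter _ fun j _ =>
      ((C.measurable_decode j d H _).comp (measurable_pi_apply j)) (measurableSet_singleton _)
  let ρ : Library L F → Measure (Fin 3 → Fin T → Fin N → ℂ) := fun w =>
    (noiseLaw T N).map fun n j t a => X w j t a + n j t a
  let μ : (Fin T → Fin 3 × Fin N → ℂ) → Measure (Fin 3 → Fin T → Fin N → ℂ) := fun q =>
    Measure.pi fun j => Measure.pi fun t => Measure.pi fun a =>
      dominatingGaussian (if j ∈ J then q t (j, a) else 0)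
  -- The label records what the caches of `J` know about the files requested by `J`, and all other
  -- files in full. It therefore fixes the caches of `J`; an observation decoded correctly by `J`
  -- then fixes the whole library.
  let label : Library L F → ((j : J) → (i : J) → Fin (c j (d i))) ×
      ({l // l ∈ (J.image d)ᶜ} → Fin (2 ^ F)) := fun w =>
    (fun j i => g j (d i) (w (d i)), fun l => w l)
  have hρ : ∀ w, ρ w ≤ μ (k w) := fun w => map_add_noiseLaw_le fun j t a => by
    by_cases hj : j ∈ J
    · simpa [X, hj] using hk w t j hj a
    · simp [X, hj]
  have hdisj : ∀ w w', label w = label w' → w ≠ w' → Disjoint (A w) (A w') := by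
    intro w w' hl hne
    rw [Set.disjoint_left]
    intro y hy hy'
    refine hne (funext fun l => ?_)
    by_cases hlJ : l ∈ J.image d
    · obtain ⟨j, hj, rfl⟩ := Finset.mem_image.1 hlJ
      rw [← hy j hj, ← hy' j hj]
      congr 1
      refine hg j w w' fun l => ?_
      by_cases hlJ : l ∈ J.image d
      · obtain ⟨i, hi, rfl⟩ := Finset.mem_image.1 hlJ
        exact congrFun (congrFun (congrArg Prod.fst hl) ⟨j, hj⟩) ⟨i, hi⟩
      · rw [show w l = w' l from
          congrFun (congrArg Prod.snd hl) ⟨l, Finset.mem_compl.2 hlJ⟩]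
    · exact congrFun (congrArg Prod.snd hl) ⟨l, Finset.mem_compl.2 hlJ⟩
  have hsum := sum_measure_le_card_mul_card_mul ρ (Fintype.piFinset fun _ : Fin T => Q) μ k
    (fun w => Fintype.mem_piFinset.2 (hkQ w)) hρ _ (fun q => (pi_dominatingGaussian_univ _).le)
    A hA label hdisj
  have hρA : ∀ w, ρ w (A w) = noiseLaw T N (Prod.mk w ⁻¹'
      {p | ∀ j ∈ J, C.estimate d H p.1 p.2 j = p.1 (d j)}) := by
    intro w
    rw [Measure.map_apply (by fun_prop) (hA w)]
    congr 1
    ext n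
    simp only [A, Set.mem_preimage, Set.mem_ofPred_eq]
    refine forall₂_congr fun j hj => ?_
    simp only [X, hj, if_true]
    rfl
  simp only [hρA] at hsum
  rw [← libraryLaw_prod_apply _ _ (C.measurableSet_estimate_eq d H J)] at hsum
  have hlow : ((2 : ENNReal) ^ F) ^ L * 2⁻¹ ≤ _ :=
    (mul_le_mul_right (C.half_le_prod_estimate_eq d H J herr) _).trans hsum
  have hcard : Fintype.card (((j : J) → (i : J) → Fin (c j (d i))) ×
      ({l // l ∈ (J.image d)ᶜ} → Fin (2 ^ F))) =
      (∏ j ∈ J, ∏ i ∈ J, c j (d i)) * (2 ^ F) ^ (L - J.card) := by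
    rw [Fintype.card_prod, Fintype.card_fun, Fintype.card_coe, Finset.card_compl,
      Finset.card_image_of_injective _ hd]
    simp only [Fintype.card_pi, Fintype.card_fin]
    congr 1
    rw [← Finset.prod_coe_sort J]
    exact Finset.prod_congr rfl fun j _ => Finset.prod_coe_sort J fun i => c j (d i)
  rw [hcard, Fintype.card_piFinset] at hlow
  have hreal := ENNReal.toReal_mono (by finiteness) hlow
  rw [ENNReal.toReal_mul, ENNReal.toReal_mul, ENNReal.toReal_mul] at hreal
  simp only [ENNReal.toReal_pow, ENNReal.toReal_natCast, ENNReal.toReal_ofNat,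
    ENNReal.toReal_inv, ENNReal.toReal_ofReal (show 0 ≤ (2 * Real.exp 2) ^ (3 * N) by positivity),
    Finset.prod_const, Finset.card_univ, Fintype.card_fin] at hreal
  push_cast at hreal
  have hJL : J.card ≤ L := by
    have := Finset.card_le_univ (J.image d)
    rwa [Finset.card_image_of_injective _ hd, Fintype.card_fin] at this
  -- The revealed files contribute the same factor to both sides and cancel.
  have hsplit : ((2 : ℝ) ^ F) ^ L = 2 ^ (F * J.card) * (2 ^ F) ^ (L - J.card) := by
    rw [pow_mul, ← pow_add, Nat.add_sub_cancel' hJL]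
  rw [hsplit] at hreal
  have hpos : (0 : ℝ) < (2 ^ F) ^ (L - J.card) := by positivity
  refine le_of_mul_le_mul_right ?_ hpos
  rw [mul_pow]
  linarith

end Code

end CacheMIMO

/-! ### Averaging over demands and the asymptotic bound -/

namespace CacheMIMO

/-- Without inter-file coding, the files can be requested in such a way that the caches of the
receivers in `J` hold at most the average amount of information about the files requested by `J`. -/
theorem Code.exists_demand {L M N F : ℕ} {μT μR P : ℝ} (hL : 3 ≤ L) (hμR : 0 ≤ μR)
    (C : Code L M N μT μR F P) (J : Finset (Fin 3)) :
    ∃ (d : Demand L) (c : Fin 3 → Fin L → ℕ)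
      (g : (j : Fin 3) → (l : Fin L) → Fin (2 ^ F) → Fin (c j l)),
      Function.Injective d ∧
      (∀ j w w', (∀ l, g j l (w l) = g j l (w' l)) → C.rxCache j w = C.rxCache j w') ∧
      0 < ∏ j ∈ J, ∏ i ∈ J, (c j (d i) : ℝ) ∧
      Real.logb 2 (∏ j ∈ J, ∏ i ∈ J, (c j (d i) : ℝ)) ≤ F * (J.card * (J.card * μR)) := by
  choose c g e he using C.rxCache_noInterFile
  have hc : ∀ j l, 0 < c j l := fun j l => (Nat.zero_le _).trans_lt (g j l 0).isLt
  have hc' : ∀ j l, (0 : ℝ) < c j l := fun j l => by exact_mod_cast hc j l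
  -- The injective labelling makes the numbers of encodings multiply to at most the number of cache
  -- states, so the bits spent on the separate files add up.
  have hsize : ∀ j, ∑ l, Real.logb 2 (c j l) ≤ F * (μR * L) := by
    intro j
    have h1 : ∏ l, c j l ≤ 2 ^ ⌊(F : ℝ) * (μR * L)⌋₊ := by
      simpa using Fintype.card_le_of_embedding (e j)
    have h2 : ∏ l, (c j l : ℝ) ≤ (2 : ℝ) ^ ⌊(F : ℝ) * (μR * L)⌋₊ := by exact_mod_cast h1
    rw [← Real.logb_prod _ _ fun l _ => (hc' j l).ne']
    calc _ ≤ Real.logb 2 ((2 : ℝ) ^ ⌊(F : ℝ) * (μR * L)⌋₊) :=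
          Real.logb_le_logb_of_le (by norm_num) (Finset.prod_pos fun l _ => hc' j l) h2
      _ = ⌊(F : ℝ) * (μR * L)⌋₊ := by
          rw [Real.logb_pow, Real.logb_self_eq_one (by norm_num), mul_one]
      _ ≤ _ := Nat.floor_le (by positivity)
  have : NeZero L := ⟨by omega⟩
  -- Receiver `j` will request file `a + j` modulo `L`, which is injective in `j` as `3 ≤ L`. Over
  -- all shifts `a` every file is requested equally often, so some shift is at most average.
  let S : Finset (Fin L) := J.map (Fin.castLEEmb hL)
  obtain ⟨a, ha⟩ := exists_sum_translate_le (fun l => ∑ j ∈ J, Real.logb 2 (c j l)) S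
    (J.card * (F * μR)) (by
      rw [Finset.sum_comm, Fintype.card_fin]
      calc _ ≤ ∑ _j ∈ J, F * (μR * L) := Finset.sum_le_sum fun j _ => hsize j
        _ = _ := by rw [Finset.sum_const, nsmul_eq_mul]; ring)
  refine ⟨fun j => a + Fin.castLE hL j, c, g, ?_, ?_, ?_, ?_⟩
  · intro i j hij
    exact Fin.castLE_injective hL (add_left_cancel hij)
  · intro j w w' h
    rw [he, he]
    congr 1
    exact funext h
  · exact Finset.prod_pos fun j _ => Finset.prod_pos fun i _ => hc' _ _
  · rw [Real.logb_prod _ _ fun j _ => (Finset.prod_pos fun i _ => hc' _ _).ne']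
    simp_rw [Real.logb_prod _ _ fun i _ => (hc' _ _).ne']
    rw [Finset.sum_comm]
    simp only [S, Finset.sum_map, Finset.card_map, Fin.castLEEmb_apply] at ha
    linarith

theorem tendsto_div_add_mul {a m : ℝ} (hm : m ≠ 0) :
    Tendsto (fun x : ℝ => x / (a + m * x)) atTop (𝓝 (1 / m)) := by
  have h1 : Tendsto (fun x : ℝ => 1 / (a / x + m)) atTop (𝓝 (1 / (0 + m))) :=
    tendsto_const_nhds.div ((tendsto_const_nhds.div_atTop tendsto_id).add tendsto_const_nhds)
      (by simpa using hm)
  rw [zero_add] at h1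
  refine h1.congr' ?_
  filter_upwards [eventually_gt_atTop 0] with x hx
  rw [div_add' _ _ _ hx.ne', one_div_div]

/-- The converse for one channel state. If the noiseless signals at the receivers in `J` are linear
images of `card κ` scalar signals of power `O(P)`, then the normalized delivery time is at least
`s (1 - s μR) / card κ` with `s = card J`. -/
theorem Scheme.HasNDT.le {L M N : ℕ} {μT μR : ℝ} (hL : 3 ≤ L) (hμR : 0 ≤ μR)
    {S : Scheme L M N μT μR} {H : CSI M N}
    (hS : ∀ n : ℕ, 0 < n → Tendsto (fun F => (S n F).worstErrorProb H) atTop (𝓝 0))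
    {τ : EReal} (hτ : S.HasNDT H τ) (J : Finset (Fin 3)) {κ : Type*} [Fintype κ] [Nonempty κ]
    (G : Fin 3 × Fin N → κ → ℂ) (β : ℝ) (hβ : 0 ≤ β)
    (hG : ∀ (P : ℝ) (F : ℕ) (C : Code L M N μT μR F P) (d : Demand L) (w : Library L F)
      (t : Fin (C.blockLength d H)), ∃ z : κ → ℂ, (∀ k, ‖z k‖ ≤ β * √P) ∧
        ∀ j ∈ J, ∀ a, C.noiseless d H w j t a = ∑ k, G (j, a) k * z k) :
    ((J.card * (1 - J.card * μR) / Fintype.card κ : ℝ) : EReal) ≤ τ := by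
  obtain ⟨b, hb, hcover⟩ := exists_finset_cover_linear_image G
  set m := Fintype.card κ with hm
  have hm0 : (0 : ℝ) < m := by exact_mod_cast Fintype.card_pos
  set s : ℝ := (J.card : ℝ)
  -- For `1 ≤ P` the number of quantization points times the dominating mass, per slot, is at most
  -- `K * P ^ m`.
  set K : ℝ := (b * (β + 1)) ^ (2 * m) * (2 * Real.exp 2) ^ (3 * N) with hK
  have hK1 : 1 ≤ K := by
    have h1 : 1 ≤ b * (β + 1) := by nlinarith
    have h2 : 1 ≤ 2 * Real.exp 2 := by nlinarith [Real.add_one_le_exp (2 : ℝ)]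
    exact one_le_mul_of_one_le_of_one_le (one_le_pow₀ h1) (one_le_pow₀ h2)
  -- At `x = log P` this compares `log P` with the bits that one slot can carry; it tends to `1 /
  -- m`.
  set ratio : ℝ → ℝ := fun x => x / (Real.logb 2 K + m * x) with hratio
  have hblock : ∀ P : ℝ, 1 ≤ P → ∀ (F : ℕ) (C : Code L M N μT μR F P),
      C.worstErrorProb H ≤ 6⁻¹ →
      F * s ≤ 1 + F * (s * (s * μR)) +
        C.maxBlockLength H * (Real.logb 2 K + m * Real.logb 2 P) := by
    intro P hP F C herr
    obtain ⟨d, c, g, hd, hg, hpos, hlog⟩ := C.exists_demand hL hμR J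
    obtain ⟨Q, hQcard, hQ⟩ := hcover (β * √P) (by positivity)
    have hmain := C.two_pow_le d hd H J
      (fun j => (le_iSup₂ (f := fun d j => C.errorProb d H j) d j).trans herr) Q
      (fun w t => by
        obtain ⟨z, hz, hz'⟩ := hG P F C d w t
        obtain ⟨q, hq, hq'⟩ := hQ z hz
        exact ⟨q, hq, fun j hj a => by rw [hz' j hj a]; exact hq' (j, a)⟩) c g hg
    have hsq : 1 ≤ √P := Real.one_le_sqrt.2 hP
    have hQK : Q.card * (2 * Real.exp 2) ^ (3 * N) ≤ K * P ^ m := by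
      have h1 : b * (β * √P) + b ≤ b * (β + 1) * √P := by nlinarith
      calc Q.card * (2 * Real.exp 2) ^ (3 * N)
          ≤ (b * (β + 1) * √P) ^ (2 * m) * (2 * Real.exp 2) ^ (3 * N) := by
            gcongr
            exact hQcard.trans (pow_le_pow_left₀ (by positivity) h1 _)
        _ = K * P ^ m := by
            rw [mul_pow _ (√P), pow_mul (√P), Real.sq_sqrt (by linarith), hK]; ring
    have hKP : 1 ≤ K * P ^ m := one_le_mul_of_one_le_of_one_le hK1 (one_le_pow₀ hP)
    have hT : C.blockLength d H ≤ C.maxBlockLength H :=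
      Finset.le_sup (f := fun d => C.blockLength d H) (Finset.mem_univ d)
    have hfin : (2 : ℝ) ^ (F * J.card) ≤ 2 * (∏ j ∈ J, ∏ i ∈ J, (c j (d i) : ℝ)) *
        (K * P ^ m) ^ C.maxBlockLength H := by
      refine hmain.trans ?_
      gcongr
      exact (pow_le_pow_left₀ (by positivity) hQK _).trans (pow_le_pow_right₀ hKP hT)
    have hl := Real.logb_le_logb_of_le (b := 2) (by norm_num) (by positivity) hfin
    rw [Real.logb_pow, Real.logb_mul (by positivity) (by positivity),
      Real.logb_mul (by norm_num) hpos.ne', Real.logb_pow,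
      Real.logb_mul (by positivity) (by positivity), Real.logb_pow,
      Real.logb_self_eq_one (by norm_num)] at hl
    push_cast at hl
    linarith
  have hdel : ∀ n : ℕ, 1 < n → ((s * (1 - s * μR) * ratio (Real.logb 2 n) : ℝ) : EReal) ≤
      S.deliveryTime H n := by
    intro n hn
    have hn1 : (1 : ℝ) < n := by exact_mod_cast hn
    have hx : 0 < Real.logb 2 n := Real.logb_pos (by norm_num) hn1
    have hden : 0 < Real.logb 2 K + m * Real.logb 2 n := by
      have := Real.logb_nonneg (b := 2) (by norm_num) hK1
      positivity
    have hlim : Tendsto (fun F : ℕ => (((s * (1 - s * μR) - 1 / F) * ratio (Real.logb 2 n) : ℝ) :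
        EReal)) atTop (𝓝 ((s * (1 - s * μR) * ratio (Real.logb 2 n) : ℝ) : EReal)) := by
      refine (continuous_coe_real_ereal.tendsto _).comp ?_
      have := ((tendsto_const_nhds (x := s * (1 - s * μR))).sub
        tendsto_one_div_atTop_nhds_zero_nat).mul_const (ratio (Real.logb 2 n))
      simpa using this
    rw [← hlim.limsup_eq]
    refine limsup_le_limsup ?_
    filter_upwards [(hS n (by omega)).eventually_le_const (u := 6⁻¹) (by norm_num),
      eventually_gt_atTop 0] with F hF hF0
    have hF' : (0 : ℝ) < F := by exact_mod_cast hF0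
    rw [EReal.coe_le_coe_iff]
    have h := hblock n hn1.le F (S n F) hF
    have e1 : (s * (1 - s * μR) - 1 / F) * ratio (Real.logb 2 n) =
        (F * s - 1 - F * (s * (s * μR))) * Real.logb 2 n /
          (F * (Real.logb 2 K + m * Real.logb 2 n)) := by
      simp only [hratio]
      field_simp
      ring
    have e2 : ((S n F).maxBlockLength H : ℝ) / (F / Real.logb 2 n) =
        ((S n F).maxBlockLength H * (Real.logb 2 K + m * Real.logb 2 n)) * Real.logb 2 n /
          (F * (Real.logb 2 K + m * Real.logb 2 n)) := by
      rw [mul_right_comm, mul_div_mul_right _ _ hden.ne', div_div_eq_mul_div]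
    rw [e1, e2]
    gcongr
    linarith
  have hlog : Tendsto (fun n : ℕ => Real.logb 2 n) atTop atTop :=
    (Real.tendsto_logb_atTop (by norm_num)).comp tendsto_natCast_atTop_atTop
  have h1 : Tendsto (fun n : ℕ => ((s * (1 - s * μR) * ratio (Real.logb 2 n) : ℝ) : EReal)) atTop
      (𝓝 ((s * (1 - s * μR) / m : ℝ) : EReal)) := by
    refine (continuous_coe_real_ereal.tendsto _).comp ?_
    have := ((tendsto_div_add_mul (a := Real.logb 2 K) hm0.ne').comp hlog).const_mul
      (s * (1 - s * μR))
    simpa [hratio, div_eq_mul_inv] using this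
  refine le_of_tendsto_of_tendsto h1 (hτ.comp tendsto_natCast_atTop_atTop) ?_
  filter_upwards [eventually_gt_atTop 1] with n hn
  exact hdel n hn

theorem Code.norm_encode_le {L M N F : ℕ} {μT μR P : ℝ} (C : Code L M N μT μR F P) (i : Fin 3)
    (d : Demand L) (H : CSI M N) (u : CacheContent L F μT) (t : Fin (C.blockLength d H))
    (m : Fin M) : ‖C.encode i d H u t m‖ ≤ √P :=
  Real.le_sqrt_of_sq_le ((Finset.single_le_sum (f := fun m => ‖C.encode i d H u t m‖ ^ 2)
    (fun _ _ => by positivity) (Finset.mem_univ m)).trans (C.power_le i d H u t))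

instance (M N : ℕ) (ν : Measure ℂ) [IsProbabilityMeasure ν] :
    IsProbabilityMeasure (channelLaw M N ν) := by
  unfold channelLaw
  infer_instance

/-- A bound which holds in every channel state holds for the minimum NDT. -/
theorem le_minNDT {L M N : ℕ} {μT μR : ℝ} {ν : Measure ℂ} [IsProbabilityMeasure ν] {x : EReal}
    (hx : ∀ (S : Scheme L M N μT μR) (H : CSI M N) (τ : EReal),
      (∀ n : ℕ, 0 < n → Tendsto (fun F => (S n F).worstErrorProb H) atTop (𝓝 0)) →
      S.HasNDT H τ → x ≤ τ) : x ≤ minNDT L M N μT μR ν := by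
  refine le_sInf fun τ hτ => ?_
  obtain ⟨S, hS, hS'⟩ := hτ
  -- The exceptional null set of channels depends on the power. Restricting to integer powers leaves
  -- a countable union of null sets, and a conull set of a probability measure contains some `H`.
  have h : ∀ᵐ H ∂(channelLaw M N ν), ∀ n : ℕ, 0 < n →
      Tendsto (fun F => (S n F).worstErrorProb H) atTop (𝓝 0) :=
    ae_all_iff.2 fun n => by
      by_cases hn : 0 < n
      · filter_upwards [hS n (by exact_mod_cast hn)] with H hH _ using hH
      · exact Eventually.of_forall fun H h => absurd h hn
  obtain ⟨H, h1, τ', h2, h3⟩ := (h.and hS').exists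
  exact (hx S H τ' h1 h2).trans h3

end CacheMIMO

/-! ### The receive-side and transmit-side cuts -/

theorem theorem2 (L M N : ℕ) (hL : 3 ≤ L) (hM : 1 ≤ M) (hN : 1 ≤ N)
    (μT μR : ℝ) (hμT₀ : 0 ≤ μT) (hμT₁ : μT ≤ 1) (hμR₀ : 0 ≤ μR) (hμR₁ : μR ≤ 1)
    (hμ : 1 ≤ μR + 3 * μT)
    (ν : Measure ℂ) [IsProbabilityMeasure ν] (hν : ∀ z : ℂ, ν {z} = 0) :
    ((max ((1 - μR) / N)
        ((Finset.Icc 1 3).sup' (by simp) fun s : ℕ => (s : ℝ) * (1 - s * μR) / (3 * M)) : ℝ) :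
      EReal) ≤ CacheMIMO.minNDT L M N μT μR ν := by
  have : Nonempty (Fin M) := ⟨⟨0, hM⟩⟩
  have : Nonempty (Fin N) := ⟨⟨0, hN⟩⟩
  refine CacheMIMO.le_minNDT fun S H τ hS hτ => ?_
  have hrx : (((1 - μR) / N : ℝ) : EReal) ≤ τ := by
    -- Here the scalars are the `N` noiseless received signals themselves, with `G` the identity;
    -- `β` bounds the channel gain to receiver `0`.
    have := hτ.le hL hμR₀ hS {0} (κ := Fin N) (fun p k => if p.2 = k then 1 else 0)
      (∑ i, ∑ a, ∑ m, ‖H i 0 a m‖) (by positivity) (fun P F C d w t => by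
        refine ⟨C.noiseless d H w 0 t, fun a => ?_, fun j hj a => ?_⟩
        · calc ‖C.noiseless d H w 0 t a‖ ≤ ∑ i, ∑ m, ‖H i 0 a m‖ * √P := by
                refine (norm_sum_le _ _).trans (Finset.sum_le_sum fun i _ => ?_)
                refine (norm_sum_le _ _).trans (Finset.sum_le_sum fun m _ => ?_)
                rw [norm_mul]
                gcongr
                exact C.norm_encode_le _ _ _ _ _ _
            _ = (∑ i, ∑ m, ‖H i 0 a m‖) * √P := by simp only [Finset.sum_mul]
            _ ≤ _ := by
                gcongr with i
                exact Finset.single_le_sum (f := fun a => ∑ m, ‖H i 0 a m‖)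
                  (fun _ _ => by positivity) (Finset.mem_univ a)
        · rw [Finset.mem_singleton.1 hj]
          simp)
    simpa using this
  have htx : ∀ s ∈ Finset.Icc (1 : ℕ) 3, (((s : ℝ) * (1 - s * μR) / (3 * M) : ℝ) : EReal) ≤ τ := by
    intro s hs
    obtain ⟨J, -, hJ⟩ := Finset.exists_subset_card_eq (s := (Finset.univ : Finset (Fin 3)))
      (n := s) (by simpa using (Finset.mem_Icc.1 hs).2)
    -- Here the scalars are the `3 * M` transmitted signals, with `G` the channel itself; the power
    -- constraint gives `β = 1`.
    have := hτ.le hL hμR₀ hS J (κ := Fin 3 × Fin M) (fun p k => H k.1 p.1 p.2 k.2)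
      1 zero_le_one (fun P F C d w t => by
        refine ⟨fun k => C.encode k.1 d H (C.txCache k.1 w) t k.2, fun k => ?_, fun j _ a => ?_⟩
        · rw [one_mul]
          exact C.norm_encode_le _ _ _ _ _ _
        · rw [Fintype.sum_prod_type]
          rfl)
    simpa [hJ] using this
  rw [EReal.coe_strictMono.monotone.map_max]
  refine max_le hrx ?_
  obtain ⟨s, hs, h⟩ := Finset.exists_mem_eq_sup' (s := Finset.Icc 1 3) (by simp)
    fun s : ℕ => (s : ℝ) * (1 - s * μR) / (3 * M)
  rw [h]
  exact htx s hs
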